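/- Let $G=(S,T,E)$ be a finite bipartite graph with vertex set $V=S\sqcup T$, and let every edge $e\in E$ have a weight $w(e)>0$. For a matching $M$ of $G$ let $V(M)$ be the set of vertices covered by $M$, let $B(M)=V(M)\,\Delta\,S$ (symmetric difference), and let $w(M)=\prod_{e\in M}w(e)$. Let $M$ be a random matching of $G$ whose distribution is given by probabilities proportional to the weights $w(M)$. Let $V_+$ and $V_-$ be disjoint subsets of $V$ such that at least one matching $M$ of $G$ satisfies $V_+\subseteq B(M)$ and $V_-\cap B(M)=\emptyset$. Let $M'$ have the distribution of $M$ conditioned on the event that $V_+\subseteq B(M)$ and $V_-\cap B(M)=\emptyset$. Put $V'=V\setminus(V_+\cup V_-)$ and $B'(M')=B(M')\cap V'$, a random subset of $V'$. Then $B'(M')$ satisfies the BK inequality for increasing events: for all upward closed families $\mathcal A,\mathcal B\subseteq 2^{V'}$, \[\mathbb P\big(B'(M')\in\mathcal A\,\square\,\mathcal B\big)\le \mathbb P\big(B'(M')\in\mathcal A\big)\,\mathbb P\big(B'(M')\in\mathcal B\big),\] where $\mathcal A\,\square\,\mathcal B=\{A\cup B : A\in\mathcal A,\ B\in\mathcal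 B,\ A\cap B=\emptyset\}$. -/

import Mathlib

open scoped symmDiff ENNReal

noncomputable section

/-- For events `𝒜`, `ℬ` in the power set of `U`: the sets `A ∪ B` with `A ∈ 𝒜`, `B ∈ ℬ` and
`A ∩ B = ∅`; the event that `𝒜` and `ℬ` occur disjointly. -/
def disjointOccurrence {U : Type*} (𝒜 ℬ : Set (Set U)) : Set (Set U) :=
  {C | ∃ A ∈ 𝒜, ∃ B ∈ ℬ, A ∩ B = ∅ ∧ C = A ∪ B}

/-- The random subset of `U` with law `p` satisfies the BK inequality for increasing events.
Here `p.toOuterMeasure 𝒜` is the probability that the random subset belongs to `𝒜`. -/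
def SatisfiesBK {U : Type*} (p : PMF (Set U)) : Prop :=
  ∀ 𝒜 ℬ : Set (Set U), IsUpperSet 𝒜 → IsUpperSet ℬ →
    p.toOuterMeasure (disjointOccurrence 𝒜 ℬ) ≤ p.toOuterMeasure 𝒜 * p.toOuterMeasure ℬ

namespace SimpleGraph

variable {V : Type*} {G : SimpleGraph V}

/-- The matchings of `G`. The vertices of `M : G.Matching` are exactly the covered ones. -/
abbrev Matching (G : SimpleGraph V) : Type _ := {M : G.Subgraph // M.IsMatching}

namespace Matching

/-- `B(M) = V(M) ∆ S`. -/
def B (S : Set V) (M : G.Matching) : Set V := M.1.verts ∆ S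

/-- The weight of a matching: the product of the weights of its edges. -/
def weight [Finite V] (w : Sym2 V → ℝ) (M : G.Matching) : ℝ :=
  ∏ e ∈ (Set.toFinite M.1.edgeSet).toFinset, w e

theorem weight_pos [Finite V] {w : Sym2 V → ℝ} (hw : ∀ e ∈ G.edgeSet, 0 < w e)
    (M : G.Matching) : 0 < M.weight w :=
  Finset.prod_pos fun e he => hw e (M.1.edgeSet_subset ((Set.Finite.mem_toFinset _).1 he))

/-- The empty matching. -/
instance : Inhabited G.Matching := ⟨⟨⊥, fun _ hv => hv.elim⟩⟩

theorem tsum_weight_ne_zero [Finite V] {w : Sym2 V → ℝ} (hw : ∀ e ∈ G.edgeSet, 0 < w e) :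
    ∑' M : G.Matching, ENNReal.ofReal (M.weight w) ≠ 0 := by
  rw [Ne, ENNReal.tsum_eq_zero]
  intro h
  exact (ENNReal.ofReal_pos.2 (weight_pos hw default)).ne' (h default)

theorem tsum_weight_ne_top [Finite V] (w : Sym2 V → ℝ) :
    ∑' M : G.Matching, ENNReal.ofReal (M.weight w) ≠ ∞ := by
  have := Fintype.ofFinite G.Matching
  rw [tsum_fintype]
  exact ENNReal.sum_ne_top.2 fun _ _ => ENNReal.ofReal_ne_top

end Matching

open Matching

/-- The law of the random matching whose probability of being `M` is proportional to the weight
of `M`. -/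
def weightedMatching [Finite V] (G : SimpleGraph V) (w : Sym2 V → ℝ)
    (hw : ∀ e ∈ G.edgeSet, 0 < w e) : PMF G.Matching :=
  PMF.normalize (fun M => ENNReal.ofReal (M.weight w)) (tsum_weight_ne_zero hw)
    (tsum_weight_ne_top w)

/-- The matchings `M` with `V₊ ⊆ B(M)` and `V₋ ∩ B(M) = ∅`. -/
def conditioningEvent (G : SimpleGraph V) (S Vp Vm : Set V) : Set G.Matching :=
  {M | Vp ⊆ M.B S ∧ Vm ∩ M.B S = ∅}

theorem exists_mem_support [Finite V] {w : Sym2 V → ℝ} (hw : ∀ e ∈ G.edgeSet, 0 < w e)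
    {s : Set G.Matching} (hs : s.Nonempty) : ∃ M ∈ s, M ∈ (G.weightedMatching w hw).support := by
  obtain ⟨M, hM⟩ := hs
  refine ⟨M, hM, ?_⟩
  rw [weightedMatching, PMF.mem_support_normalize_iff]
  exact (ENNReal.ofReal_pos.2 (weight_pos hw M)).ne'

/-- The law of `M'`: the weighted random matching conditioned on `V₊ ⊆ B(M)` and
`V₋ ∩ B(M) = ∅`. -/
def conditionedMatching [Finite V] (G : SimpleGraph V) (w : Sym2 V → ℝ)
    (hw : ∀ e ∈ G.edgeSet, 0 < w e) (S Vp Vm : Set V)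
    (hne : (G.conditioningEvent S Vp Vm).Nonempty) : PMF G.Matching :=
  (G.weightedMatching w hw).filter (G.conditioningEvent S Vp Vm) (exists_mem_support hw hne)

/-- `B(M) ∩ V'` as a subset of `V'`. -/
def Matching.restrictB (S V' : Set V) (M : G.Matching) : Set V' := {v | (v : V) ∈ M.B S}

end SimpleGraph

end

/-!
Let `M` and `N` be independent copies of the random matching. Exchanging them on an arbitrary set
of components of `M ∪ N` preserves the law of the pair, so the exchanges may be decided by fair
coins. Orienting the edges of `M` into `S` and those of `N` out of `S` turns each component into a
directed path or cycle, and a vertex of `B(M) \ B(N)` has no incoming edge, so each component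
contains at most one of them. Hence, once the pair is fixed up to exchanges, disjoint occurrence
of two increasing events for `B(M)` is a disjoint occurrence `□` of two events of the coins.
Reimer's inequality bounds the number of such coin outcomes by that of the outcomes for which the
first event occurs and the second one occurs after all coins are reversed. Reversing the coins
swaps `M` and `N`, so averaging over the pair gives the product of the two probabilities.
-/

section Reimer

open Matrix Set

variable {ι α R : Type*}

/-- The event `A □ B` of Reimer's inequality: the points `x` such that, for some set `s` of
coordinates, the values of `x` on `s` witness `A` and its values off `s` witness `B`. -/
def reimerBox (A B : Set (ι → α)) : Set (ι → α) :=
  {x | ∃ s : Set ι, (∀ z, EqOn z x s → z ∈ A) ∧ ∀ z, EqOn z x sᶜ → z ∈ B}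

section TensorPower

variable [Fintype ι]

/-- The tensor product `⨂ i, v i`, as a function on the index set `ι → α` of the standard basis of
the tensor power. -/
def pureTensor [CommSemiring R] (v : ι → α → R) (z : ι → α) : R := ∏ i, v i (z i)

theorem pureTensor_eq_zero [CommSemiring R] {v : ι → α → R} {z : ι → α} {i : ι}
    (h : v i (z i) = 0) : pureTensor v z = 0 :=
  Finset.prod_eq_zero (Finset.mem_univ i) h

theorem pureTensor_dotProduct [CommSemiring R] [DecidableEq ι] [Fintype α] (v w : ι → α → R) :
    pureTensor v ⬝ᵥ pureTensor w = ∏ i, v i ⬝ᵥ w i := by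
  simp only [dotProduct, pureTensor, ← Finset.prod_mul_distrib, Fintype.prod_sum]

theorem pureTensor_single [CommSemiring R] [DecidableEq α] [DecidableEq (ι → α)] (x : ι → α) :
    pureTensor (fun i => Pi.single (x i) (1 : R)) = Pi.single x 1 := by
  ext z
  simp only [pureTensor, Pi.single_apply, Finset.prod_ite_zero, funext_iff, Finset.mem_univ,
    true_imp_iff, Finset.prod_const_one]

open scoped Classical in
/-- The vector attached to the cylinder of the points that agree with `x` on `s`. The factor
`2 e_{¬x i} - e_{x i}` at a free coordinate `i` is chosen to be congruent to `e_{x i}` modulo 2 and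
to be mapped to a multiple of `e_{¬x i}` by `!![2, 1; 1, 2]`. -/
noncomputable def cylinderVec (s : Set ι) (x : ι → Bool) : (ι → Bool) → ℤ :=
  pureTensor fun i =>
    if i ∈ s then Pi.single (x i) 1 else 2 • Pi.single (!x i) 1 - Pi.single (x i) 1

/-- The tensor power of the positive definite matrix `!![2, 1; 1, 2]`. -/
def agreementMatrix (ι : Type*) [Fintype ι] : Matrix (ι → Bool) (ι → Bool) ℤ :=
  .of fun z => pureTensor fun i b => if b = z i then 2 else 1

/-- The incidence matrix between the subcubes of `ι → Bool` and their points; the subcube `t` fixes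
the coordinate `i` to the value `b` if `t i = some b` and leaves it free if `t i = none`. -/
def subcubeMatrix (ι : Type*) [Fintype ι] : Matrix (ι → Option Bool) (ι → Bool) ℤ :=
  .of fun t z => pureTensor (fun i o => if o = none ∨ o = some (z i) then 1 else 0) t

theorem cylinderVec_apply_eq_zero {s : Set ι} {x z : ι → Bool} (h : ¬ EqOn z x s) :
    cylinderVec s x z = 0 := by
  obtain ⟨i, hi, hne⟩ : ∃ i ∈ s, z i ≠ x i := by simpa [EqOn] using h
  exact pureTensor_eq_zero (i := i) (by simp [hi, hne])

theorem intCast_cylinderVec [DecidableEq (ι → Bool)] (s : Set ι) (x z : ι → Bool) :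
    (cylinderVec s x z : ZMod 2) = (Pi.single x 1 : (ι → Bool) → ZMod 2) z := by
  rw [← pureTensor_single, cylinderVec, pureTensor, pureTensor, Int.cast_prod]
  refine Finset.prod_congr rfl fun i _ => ?_
  by_cases hi : i ∈ s <;> cases x i <;> cases z i <;> simp [hi] <;> rfl

theorem linearIndependent_cylinderVec (s : (ι → Bool) → Set ι) :
    LinearIndependent ℤ fun x => cylinderVec (s x) x := by
  classical
  suffices (Matrix.of fun x => cylinderVec (s x) x).det ≠ 0 from
    linearIndependent_rows_of_det_ne_zero this
  have hmod : (Int.castRingHom (ZMod 2)).mapMatrix (.of fun x => cylinderVec (s x) x) = 1 := by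
    ext x z
    simp [intCast_cylinderVec, Matrix.one_apply, Pi.single_apply, eq_comm]
  intro hdet
  have := (Int.castRingHom (ZMod 2)).map_det (.of fun x => cylinderVec (s x) x)
  rw [hdet, hmod, map_zero, det_one] at this
  exact zero_ne_one this

variable [DecidableEq ι]

theorem agreementMatrix_mulVec_cylinderVec_eq_zero {s : Set ι} {x z : ι → Bool}
    (h : ¬ EqOn zᶜ x sᶜ) : (agreementMatrix ι *ᵥ cylinderVec s x) z = 0 := by
  obtain ⟨i, hi, hne⟩ : ∃ i ∉ s, (!z i) ≠ x i := by simpa [EqOn] using h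
  change pureTensor (α := Bool) (fun i b => if b = z i then 2 else 1) ⬝ᵥ pureTensor _ = 0
  rw [pureTensor_dotProduct]
  refine Finset.prod_eq_zero (Finset.mem_univ i) ?_
  cases hx : x i <;> cases hz : z i <;> simp_all [dotProduct]

theorem agreementMatrix_eq_transpose_mul :
    agreementMatrix ι = (subcubeMatrix ι)ᵀ * subcubeMatrix ι := by
  ext z z'
  let u (b : Bool) (o : Option Bool) : ℤ := if o = none ∨ o = some b then 1 else 0
  have hu (b b' : Bool) : (if b' = b then 2 else 1) = u b ⬝ᵥ u b' := by
    cases b <;> cases b' <;> rfl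
  calc agreementMatrix ι z z' = ∏ i, u (z i) ⬝ᵥ u (z' i) :=
        Finset.prod_congr rfl fun i _ => hu (z i) (z' i)
    _ = ((subcubeMatrix ι)ᵀ * subcubeMatrix ι) z z' := (pureTensor_dotProduct _ _).symm

theorem subcubeMatrix_mulVec_some (f : (ι → Bool) → ℤ) (z : ι → Bool) :
    (subcubeMatrix ι *ᵥ f) (fun i => some (z i)) = f z := by
  have hrow : subcubeMatrix ι (fun i => some (z i)) = Pi.single z 1 := by
    rw [← pureTensor_single]
    ext z'
    simp [subcubeMatrix, pureTensor, Pi.single_apply, eq_comm]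
  rw [mulVec, hrow, single_one_dotProduct]

theorem eq_zero_of_dotProduct_agreementMatrix_mulVec_eq_zero {f : (ι → Bool) → ℤ}
    (h : f ⬝ᵥ agreementMatrix ι *ᵥ f = 0) : f = 0 := by
  rw [agreementMatrix_eq_transpose_mul, ← mulVec_mulVec, dotProduct_mulVec, vecMul_transpose,
    dotProduct_self_eq_zero] at h
  ext z
  rw [← subcubeMatrix_mulVec_some f z, h, Pi.zero_apply, Pi.zero_apply]

end TensorPower

/-- **Reimer's inequality** in its intersection form. If a combination `f` of the cylinder vectors
attached to the points of `A □ B` vanishes on the right-hand set, then `f ⬝ᵥ Q *ᵥ f = 0` for the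
agreement matrix `Q`, because `f` is supported on `A` and `Q *ᵥ f` on the complements of the points
of `B`. So restriction to the right-hand set keeps the cylinder vectors independent. -/
theorem ncard_reimerBox_le [Finite ι] (A B : Set (ι → Bool)) :
    (reimerBox A B).ncard ≤ (A ∩ compl ⁻¹' B).ncard := by
  classical
  have := Fintype.ofFinite ι
  choose! s hsA hsB using fun x (hx : x ∈ reimerBox A B) => hx
  let v (x : reimerBox A B) := cylinderVec (s x) x.1
  let restrict := LinearMap.funLeft ℤ ℤ ((↑) : ↥(A ∩ compl ⁻¹' B) → ι → Bool)
  suffices hv : LinearIndependent ℤ (restrict ∘ v) by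
    simpa only [Module.finrank_fintype_fun_eq_card, ← Nat.card_eq_fintype_card,
      Nat.card_coe_set_eq] using hv.fintype_card_le_finrank
  refine ((linearIndependent_cylinderVec s).comp _ Subtype.val_injective).map ?_
  rw [Submodule.disjoint_def]
  intro f hf hker
  have hA (z) (hz : z ∉ A) : f z = 0 :=
    LinearMap.eqOn_span (f := LinearMap.proj z) (g := 0)
      (by rintro _ ⟨x, rfl⟩; exact cylinderVec_apply_eq_zero fun h => hz (hsA x x.2 z h)) hf
  have hB (z) (hz : zᶜ ∉ B) : (agreementMatrix ι *ᵥ f) z = 0 :=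
    LinearMap.eqOn_span (f := LinearMap.proj z ∘ₗ (agreementMatrix ι).mulVecLin) (g := 0)
      (by
        rintro _ ⟨x, rfl⟩
        exact agreementMatrix_mulVec_cylinderVec_eq_zero fun h => hz (hsB x x.2 _ h)) hf
  refine eq_zero_of_dotProduct_agreementMatrix_mulVec_eq_zero (Finset.sum_eq_zero fun z _ => ?_)
  by_cases hzA : z ∈ A
  · by_cases hzB : zᶜ ∈ B
    · exact mul_eq_zero_of_left (congrFun (LinearMap.mem_ker.1 hker) ⟨z, hzA, hzB⟩) _
    · exact mul_eq_zero_of_right _ (hB z hzB)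
  · exact mul_eq_zero_of_left (hA z hzA) _

end Reimer

section AlternatingPaths

open SimpleGraph Relation

theorem reflTransGen_of_reflTransGen_symmGen {α : Type*} {r : α → α → Prop}
    (hr : Relator.LeftUnique r) {u v : α} (h : ReflTransGen (SymmGen r) u v)
    (hu : ∀ a, ¬ r a u) : ReflTransGen r u v := by
  induction h with
  | refl => exact .refl
  | @tail y z _ hyz ih =>
    obtain hyz | hzy := hyz
    · exact ih.tail hyz
    · obtain rfl | ⟨y', huy', hy'⟩ := ih.cases_tail
      · exact absurd hzy (hu z)
      · rwa [hr hzy hy']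

theorem eq_of_reflTransGen_symmGen {α : Type*} {r : α → α → Prop} (hr : Relator.LeftUnique r)
    {u v : α} (h : ReflTransGen (SymmGen r) u v) (hu : ∀ a, ¬ r a u) (hv : ∀ a, ¬ r a v) :
    u = v := by
  obtain huv | ⟨y, -, hy⟩ := (reflTransGen_of_reflTransGen_symmGen hr h hu).cases_tail
  · exact huv.symm
  · exact absurd hy (hv y)

variable {V : Type*} {G : SimpleGraph V} {S T : Set V} {M N : G.Matching} {a b u v : V}

theorem mem_iff_notMem_of_adj (hG : G.IsBipartiteWith S T) (h : G.Adj a b) : a ∈ S ↔ b ∉ S :=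
  ⟨fun ha hb => Set.disjoint_left.1 hG.disjoint hb (hG.mem_of_mem_adj ha h),
    fun hb => (hG.mem_of_adj h).elim And.left fun hab => absurd hab.2 hb⟩

/-- The graph formed by the edges of two matchings. Its components are paths and cycles along which
edges of the two matchings alternate. -/
def unionGraph (M N : G.Matching) : SimpleGraph V := M.1.spanningCoe ⊔ N.1.spanningCoe

theorem unionGraph_adj : (unionGraph M N).Adj a b ↔ M.1.Adj a b ∨ N.1.Adj a b := Iff.rfl

theorem unionGraph_comm (M N : G.Matching) : unionGraph M N = unionGraph N M := sup_comm _ _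

/-- The orientation of the edges of two matchings in which those of `M` point into `S` and those of
`N` point out of `S`, so that every component of `unionGraph M N` becomes a directed path or
cycle. -/
def AlternatingAdj (S : Set V) (M N : G.Matching) (a b : V) : Prop :=
  a ∉ S ∧ M.1.Adj a b ∨ a ∈ S ∧ N.1.Adj a b

theorem symmGen_alternatingAdj_of_adj (hG : G.IsBipartiteWith S T)
    (h : (unionGraph M N).Adj a b) : SymmGen (AlternatingAdj S M N) a b := by
  rw [unionGraph_adj] at h
  have hab : a ∈ S ↔ b ∉ S :=
    mem_iff_notMem_of_adj hG (h.elim Subgraph.Adj.adj_sub Subgraph.Adj.adj_sub)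
  have := M.1.adj_comm a b
  have := N.1.adj_comm a b
  grind [SymmGen, AlternatingAdj]

theorem leftUnique_alternatingAdj (hG : G.IsBipartiteWith S T) :
    Relator.LeftUnique (AlternatingAdj S M N) := by
  rintro a b y (⟨ha, hay⟩ | ⟨ha, hay⟩) (⟨hb, hby⟩ | ⟨hb, hby⟩)
  · exact M.2.eq_of_adj_right hay hby
  · have := mem_iff_notMem_of_adj hG hay.adj_sub
    have := mem_iff_notMem_of_adj hG hby.adj_sub
    tauto
  · have := mem_iff_notMem_of_adj hG hay.adj_sub
    have := mem_iff_notMem_of_adj hG hby.adj_sub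
    tauto
  · exact N.2.eq_of_adj_right hay hby

theorem not_alternatingAdj_of_mem_B (hG : G.IsBipartiteWith S T) (hM : v ∈ M.B S)
    (hN : v ∉ N.B S) (a : V) : ¬ AlternatingAdj S M N a v := by
  simp only [Matching.B, Set.mem_symmDiff] at hM hN
  rintro (⟨ha, hav⟩ | ⟨ha, hav⟩)
  all_goals
    have := mem_iff_notMem_of_adj hG hav.adj_sub
    have := hav.snd_mem
    tauto

theorem eq_of_reachable_unionGraph (hG : G.IsBipartiteWith S T)
    (h : (unionGraph M N).Reachable u v) (huM : u ∈ M.B S) (huN : u ∉ N.B S)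
    (hvM : v ∈ M.B S) (hvN : v ∉ N.B S) : u = v :=
  eq_of_reflTransGen_symmGen (leftUnique_alternatingAdj hG)
    (ReflTransGen.mono (fun _ _ => symmGen_alternatingAdj_of_adj hG) _ _
      ((reachable_iff_reflTransGen u v).1 h))
    (not_alternatingAdj_of_mem_B hG huM huN) (not_alternatingAdj_of_mem_B hG hvM hvN)

end AlternatingPaths

section Mix

open SimpleGraph

variable {V : Type*} {G : SimpleGraph V}

/-- A chosen vertex in the component of `v` in the graph `H`. -/
noncomputable def root (H : SimpleGraph V) (v : V) : V := (H.connectedComponentMk v).out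

theorem root_eq_root_iff {H : SimpleGraph V} {u v : V} :
    root H u = root H v ↔ H.Reachable u v := by
  rw [← ConnectedComponent.eq]
  exact (Function.LeftInverse.injective Quot.out_eq).eq_iff

/-- The one of the matchings `M` and `N` that `mix x M N` follows at the vertex `a`. -/
noncomputable def mixChoice (x : V → Bool) (M N : G.Matching) (a : V) : G.Matching :=
  if x (root (unionGraph M N) a) then M else N

theorem mixChoice_eq_of_adj {x : V → Bool} {M N : G.Matching} {a b : V}
    (h : (mixChoice x M N a).1.Adj a b) : mixChoice x M N a = mixChoice x M N b := by
  have hab : (unionGraph M N).Adj a b := by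
    unfold mixChoice at h
    split_ifs at h
    exacts [Or.inl h, Or.inr h]
  rw [mixChoice, mixChoice, root_eq_root_iff.2 hab.reachable]

/-- The matching that agrees with `M` on the components of `unionGraph M N` whose root is marked by
`x`, and with `N` on the other components. Marking vertices rather than components lets a uniformly
random marking be used for all pairs of matchings at once. -/
noncomputable def mix (x : V → Bool) (M N : G.Matching) : G.Matching where
  val :=
    { verts := {a | a ∈ (mixChoice x M N a).1.verts}
      Adj a b := (mixChoice x M N a).1.Adj a b
      adj_sub h := h.adj_sub
      edge_vert h := h.fst_mem
      symm := ⟨fun _ _ h => mixChoice_eq_of_adj h ▸ h.symm⟩ }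
  property _ ha := (mixChoice x M N _).2 ha

variable {x z : V → Bool} {M N : G.Matching} {S Vp Vm : Set V} {a b v : V}

theorem mix_adj : (mix x M N).1.Adj a b ↔ (mixChoice x M N a).1.Adj a b := Iff.rfl

theorem mem_B_mix : a ∈ (mix x M N).B S ↔ a ∈ (mixChoice x M N a).B S := Iff.rfl

theorem mixChoice_compl (x : V → Bool) (M N : G.Matching) (a : V) :
    mixChoice xᶜ M N a = mixChoice x N M a := by
  rw [mixChoice, mixChoice, unionGraph_comm, Pi.compl_apply, Bool.compl_eq_bnot]
  cases x (root (unionGraph N M) a) <;> rfl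

theorem mix_compl (x : V → Bool) (M N : G.Matching) : mix xᶜ M N = mix x N M := by
  simp only [mix, mixChoice_compl]

theorem unionGraph_mix (x : V → Bool) (M N : G.Matching) :
    unionGraph (mix x M N) (mix x N M) = unionGraph M N := by
  ext a b
  rw [unionGraph_adj, unionGraph_adj, mix_adj, mix_adj, mixChoice, mixChoice, unionGraph_comm N M]
  split_ifs
  exacts [Iff.rfl, Or.comm]

theorem mix_mix (x : V → Bool) (M N : G.Matching) : mix x (mix x M N) (mix x N M) = M := by
  have hchoice (a : V) : mixChoice x (mix x M N) (mix x N M) a =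
      if x (root (unionGraph M N) a) then mix x M N else mix x N M := by
    rw [mixChoice, unionGraph_mix]
  ext a b
  · change a ∈ (mixChoice x (mix x M N) (mix x N M) a).1.verts ↔ _
    rw [hchoice]
    split_ifs with ha
    · change a ∈ (mixChoice x M N a).1.verts ↔ _
      rw [mixChoice, if_pos ha]
    · change a ∈ (mixChoice x N M a).1.verts ↔ _
      rw [mixChoice, unionGraph_comm, if_neg ha]
  · rw [mix_adj, hchoice]
    split_ifs with ha
    · rw [mix_adj, mixChoice, if_pos ha]
    · rw [mix_adj, mixChoice, unionGraph_comm, if_neg ha]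

/-- The involution of pairs of matchings that exchanges the two matchings on the components whose
root is not marked by `x`. -/
noncomputable def mixEquiv (x : V → Bool) : Equiv.Perm (G.Matching × G.Matching) :=
  Function.Involutive.toPerm (fun p => (mix x p.1 p.2, mix x p.2 p.1)) fun _ =>
    Prod.ext (mix_mix _ _ _) (mix_mix _ _ _)

theorem mixEquiv_apply (x : V → Bool) (p : G.Matching × G.Matching) :
    mixEquiv x p = (mix x p.1 p.2, mix x p.2 p.1) := rfl

theorem mem_B_mix_of_mem (hM : v ∈ (mix x M N).B S)
    (hN : v ∉ (mix x N M).B S → z (root (unionGraph M N) v) = x (root (unionGraph M N) v)) :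
    v ∈ (mix z M N).B S := by
  simp only [mem_B_mix, mixChoice, unionGraph_comm N M] at hM hN ⊢
  grind

theorem mix_mem_conditioningEvent (hM : M ∈ G.conditioningEvent S Vp Vm)
    (hN : N ∈ G.conditioningEvent S Vp Vm) : mix x M N ∈ G.conditioningEvent S Vp Vm := by
  have hchoice (a : V) : mixChoice x M N a ∈ G.conditioningEvent S Vp Vm := by
    unfold mixChoice
    split_ifs
    exacts [hM, hN]
  exact ⟨fun a ha => (hchoice a).1 ha,
    Set.eq_empty_of_forall_notMem fun a ha => (hchoice a).2.le ha⟩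

theorem weight_eq_finprod [Finite V] (w : Sym2 V → ℝ) (M : G.Matching) :
    M.weight w = ∏ᶠ e, M.1.edgeSet.mulIndicator w e := by
  rw [← finprod_mem_def, finprod_mem_eq_finite_toFinset_prod _ (Set.toFinite _)]
  rfl

theorem weight_mix_mul [Finite V] (w : Sym2 V → ℝ) (x : V → Bool) (M N : G.Matching) :
    (mix x M N).weight w * (mix x N M).weight w = M.weight w * N.weight w := by
  classical
  simp only [weight_eq_finprod]
  rw [← finprod_mul_distrib (Set.toFinite _) (Set.toFinite _),
    ← finprod_mul_distrib (Set.toFinite _) (Set.toFinite _)]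
  refine finprod_congr fun e => ?_
  induction e with | h a b
  simp only [Set.mulIndicator_apply, Subgraph.mem_edgeSet, mix_adj, mixChoice, unionGraph_comm N M]
  split_ifs <;> simp_all [mul_comm]

end Mix

section DisjointOccurrence

open SimpleGraph

variable {V : Type*} {G : SimpleGraph V} {S T : Set V}

/-- The coordinates witnessing the first event are the roots of the components in which it uses a
vertex of exactly one of the two sets `B`. No such component is used by the second event as well,
because a component contains at most one vertex of `B(M) \ B(N)`. -/
theorem setOf_mix_mem_disjointOccurrence_subset (hG : G.IsBipartiteWith S T) {V' : Set V}
    {𝒜 ℬ : Set (Set V')} (h𝒜 : IsUpperSet 𝒜) (hℬ : IsUpperSet ℬ) (M N : G.Matching) :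
    {x | (mix x M N).restrictB S V' ∈ disjointOccurrence 𝒜 ℬ} ⊆
      reimerBox {x | (mix x M N).restrictB S V' ∈ 𝒜} {x | (mix x M N).restrictB S V' ∈ ℬ} := by
  rintro x ⟨A, hA, B, hB, hAB, hx⟩
  have hAx (v) (hv : v ∈ A) : (v : V) ∈ (mix x M N).B S := (hx.ge (Or.inl hv) :)
  have hBx (v) (hv : v ∈ B) : (v : V) ∈ (mix x M N).B S := (hx.ge (Or.inr hv) :)
  refine ⟨{r | ∃ v ∈ A, (v : V) ∉ (mix x N M).B S ∧ root (unionGraph M N) v = r},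
    fun z hz => h𝒜 (fun v hv => ?_) hA, fun z hz => hℬ (fun v hv => ?_) hB⟩
  · exact mem_B_mix_of_mem (hAx v hv) fun hvN => hz ⟨v, hv, hvN, rfl⟩
  · refine mem_B_mix_of_mem (hBx v hv) fun hvN => hz ?_
    rintro ⟨u, hu, huN, hroot⟩
    have huv : (u : V) = v := by
      refine eq_of_reachable_unionGraph hG ?_ (hAx u hu) huN (hBx v hv) hvN
      rwa [unionGraph_mix, ← root_eq_root_iff]
    exact hAB.le ⟨hu, Subtype.coe_injective huv ▸ hv⟩

theorem ncard_mix_mem_disjointOccurrence_le [Finite V] (hG : G.IsBipartiteWith S T) {V' : Set V}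
    {𝒜 ℬ : Set (Set V')} (h𝒜 : IsUpperSet 𝒜) (hℬ : IsUpperSet ℬ) (M N : G.Matching) :
    {x | (mix x M N).restrictB S V' ∈ disjointOccurrence 𝒜 ℬ}.ncard ≤
      {x | (mix x M N).restrictB S V' ∈ 𝒜 ∧ (mix x N M).restrictB S V' ∈ ℬ}.ncard := by
  refine (Set.ncard_mono (setOf_mix_mem_disjointOccurrence_subset hG h𝒜 hℬ M N)).trans ?_
  simpa only [Set.preimage_ofPred_eq, mix_compl, Set.ofPred_and] using
    ncard_reimerBox_le {x | (mix x M N).restrictB S V' ∈ 𝒜} {x | (mix x M N).restrictB S V' ∈ ℬ}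

end DisjointOccurrence

section Averaging

theorem toOuterMeasure_mul_toOuterMeasure {α β : Type*} (p : PMF α) (q : PMF β) (s : Set α)
    (t : Set β) : p.toOuterMeasure s * q.toOuterMeasure t =
      ∑' a : α × β, (s ×ˢ t).indicator (fun a => p a.1 * q a.2) a := by
  classical
  rw [PMF.toOuterMeasure_apply, PMF.toOuterMeasure_apply, ENNReal.tsum_prod',
    ← ENNReal.tsum_mul_right]
  refine tsum_congr fun a => ?_
  rw [← ENNReal.tsum_mul_left]
  refine tsum_congr fun b => ?_
  simp only [Set.indicator_apply, Set.mem_prod]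
  split_ifs <;> simp_all

theorem sum_indicator_perm_apply {X P : Type*} [Fintype X] {f : P → ℝ≥0∞}
    {σ : X → Equiv.Perm P} (hf : ∀ x p, f (σ x p) = f p) (s : Set P) (p : P) :
    ∑ x, s.indicator f (σ x p) = {x | σ x p ∈ s}.ncard * f p := by
  classical
  simp only [Set.indicator_apply, hf, Set.ncard_eq_toFinset_card', Set.toFinset_ofPred]
  rw [← Finset.sum_filter, Finset.sum_const, nsmul_eq_mul]

theorem tsum_indicator_le_of_forall_ncard_le {X P : Type*} [Finite X] [Nonempty X]
    {f : P → ℝ≥0∞} {σ : X → Equiv.Perm P} (hf : ∀ x p, f (σ x p) = f p) {s t : Set P}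
    (h : ∀ p, {x | σ x p ∈ s}.ncard ≤ {x | σ x p ∈ t}.ncard) :
    ∑' p, s.indicator f p ≤ ∑' p, t.indicator f p := by
  have := Fintype.ofFinite X
  have haverage (u : Set P) : (Fintype.card X : ℝ≥0∞) * ∑' p, u.indicator f p =
      ∑' p, {x | σ x p ∈ u}.ncard * f p := by
    calc (Fintype.card X : ℝ≥0∞) * ∑' p, u.indicator f p
        = ∑ x, ∑' p, u.indicator f (σ x p) := by
          simp only [Equiv.tsum_eq (σ _) (u.indicator f), Finset.sum_const, nsmul_eq_mul,
            Finset.card_univ]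
      _ = ∑' p, ∑ x, u.indicator f (σ x p) :=
          (Summable.tsum_finsetSum fun _ _ => ENNReal.summable).symm
      _ = ∑' p, {x | σ x p ∈ u}.ncard * f p :=
          tsum_congr fun p => sum_indicator_perm_apply hf u p
  rw [← ENNReal.mul_le_mul_iff_right (a := Fintype.card X) (by simp) (ENNReal.natCast_ne_top _),
    haverage, haverage]
  exact ENNReal.tsum_le_tsum fun p => mul_le_mul_left (Nat.cast_le.2 (h p)) _

end Averaging

section ExchangeInvariance

open SimpleGraph

variable {V : Type*} {G : SimpleGraph V} {S T : Set V}

/-- The law of a pair of independent matchings with law `μ` is invariant under exchanging the two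
matchings on the components of their union with an unmarked root, for every marking. -/
def ExchangeInvariant (μ : PMF G.Matching) : Prop :=
  ∀ x M N, μ (mix x M N) * μ (mix x N M) = μ M * μ N

theorem exchangeInvariant_weightedMatching [Finite V] {w : Sym2 V → ℝ}
    (hw : ∀ e ∈ G.edgeSet, 0 < w e) : ExchangeInvariant (G.weightedMatching w hw) := by
  intro x M N
  simp only [weightedMatching, PMF.normalize_apply]
  rw [mul_mul_mul_comm, ← ENNReal.ofReal_mul (Matching.weight_pos hw _).le, weight_mix_mul,
    ENNReal.ofReal_mul (Matching.weight_pos hw _).le, mul_mul_mul_comm]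

theorem ExchangeInvariant.filter {μ : PMF G.Matching} (hμ : ExchangeInvariant μ)
    {s : Set G.Matching} (hs : ∃ M ∈ s, M ∈ μ.support)
    (hmix : ∀ x, ∀ M ∈ s, ∀ N ∈ s, mix x M N ∈ s) : ExchangeInvariant (μ.filter s hs) := by
  classical
  intro x M N
  have hmem : mix x M N ∈ s ∧ mix x N M ∈ s ↔ M ∈ s ∧ N ∈ s := by
    refine ⟨fun ⟨h, h'⟩ => ⟨?_, ?_⟩, fun ⟨h, h'⟩ => ⟨hmix x M h N h', hmix x N h' M h⟩⟩
    · exact mix_mix x M N ▸ hmix x _ h _ h'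
    · exact mix_mix x N M ▸ hmix x _ h' _ h
  have hindicator (M N : G.Matching) :
      s.indicator μ M * s.indicator μ N = if M ∈ s ∧ N ∈ s then μ M * μ N else 0 := by
    simp only [Set.indicator_apply, ite_and]
    split_ifs <;> simp
  simp only [PMF.filter_apply]
  rw [mul_mul_mul_comm, mul_mul_mul_comm (s.indicator μ M), hindicator, hindicator, hμ x M N,
    if_congr hmem rfl rfl]

theorem ExchangeInvariant.satisfiesBK_map_restrictB [Finite V] {μ : PMF G.Matching}
    (hμ : ExchangeInvariant μ) (hG : G.IsBipartiteWith S T) (V' : Set V) :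
    SatisfiesBK (μ.map (Matching.restrictB S V')) := by
  intro 𝒜 ℬ h𝒜 hℬ
  simp only [PMF.toOuterMeasure_map_apply]
  set 𝒞 := Matching.restrictB S V' ⁻¹' disjointOccurrence 𝒜 ℬ with h𝒞
  have huniv : μ.toOuterMeasure Set.univ = 1 :=
    (μ.toOuterMeasure_apply_eq_one_iff _).2 (Set.subset_univ _)
  calc μ.toOuterMeasure 𝒞 = μ.toOuterMeasure 𝒞 * μ.toOuterMeasure Set.univ := by
        rw [huniv, mul_one]
    _ ≤ _ := by
        rw [toOuterMeasure_mul_toOuterMeasure, toOuterMeasure_mul_toOuterMeasure]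
        refine tsum_indicator_le_of_forall_ncard_le (σ := mixEquiv) (fun x p => hμ x p.1 p.2)
          fun p => ?_
        simpa [h𝒞, mixEquiv_apply] using ncard_mix_mem_disjointOccurrence_le hG h𝒜 hℬ p.1 p.2

end ExchangeInvariance

theorem theorem3 {V : Type*} [Finite V] (G : SimpleGraph V) (S T : Set V)
    (hG : G.IsBipartiteWith S T) (hST : S ∪ T = Set.univ)
    (w : Sym2 V → ℝ) (hw : ∀ e ∈ G.edgeSet, 0 < w e)
    (Vp Vm : Set V) (hdisj : Disjoint Vp Vm)
    (hne : (G.conditioningEvent S Vp Vm).Nonempty) :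
    SatisfiesBK ((G.conditionedMatching w hw S Vp Vm hne).map
      (SimpleGraph.Matching.restrictB S (Vp ∪ Vm)ᶜ)) := by
  have hμ : ExchangeInvariant (G.conditionedMatching w hw S Vp Vm hne) :=
    (exchangeInvariant_weightedMatching hw).filter _ fun _ _ hM _ hN =>
      mix_mem_conditioningEvent hM hN
  exact hμ.satisfiesBK_map_restrictB hG _
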